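/- Let $K$ be a field of characteristic different from $2$, with algebraic closure $\overline K$ and absolute Galois group $G_K=\mathrm{Aut}(\overline K/K)$. Let $c,\alpha\in K$ and $f=x^2+c$, and write $f^n$ for the $n$-th iterate of $f$. For $n\ge 0$ let $f^{-n}(\alpha)=\{\beta\in\overline K : f^n(\beta)=\alpha\}$, and let $f^{-\infty}(\alpha)=\bigcup_{n\ge 1}f^{-n}(\alpha)$. Suppose that $f^{-\infty}(\alpha)$ contains no ramification points of $f$, that is, no $\beta$ with $f'(\beta)=0$. Let $T_\infty(f,\alpha)$ be the rooted tree whose set of vertices at level $n\ge 0$ is $f^{-n}(\alpha)$ (the levels being taken as disjoint), where a vertex $\beta$ at level $n+1$ is joined to the vertex $f(\beta)$ at level $n$. This is an infinite regular rooted binary tree, so its automorphism group is identified with the automorphism group $\Omega_\infty$ of the infinite regular rooted binary tree. Let $\rho_{f,\alpha}\colon G_K\to\mathrm{Aut}(T_\infty(f,\alpha))\cong\Omega_\infty$ be the arboreal representation, given by the action of $G_K$ on the sets $f^{-n}(\alpha)$. Define $c_1=-c$ and $c_n=f(c_{n-1})$ for $n\ge 2$, and let $c_{1,\alpha}=c_1+\alpha$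 and $c_{n,\alpha}=c_n-\alpha$ for $n\ge 2$. If the image of $\rho_{f,\alpha}$ is an abelian group and $f-\alpha$ is irreducible over $K$, then $c_{n,\alpha}\neq 0$ for every $n\ge 1$, and the $\mathbb F_2$-subspace of $K^\times/{K^\times}^2$ spanned by the classes of the elements $c_{n,\alpha}$, $n\ge 1$, has dimension exactly $1$. -/

import Mathlib

open Polynomial

/-- The set `f^{-n}(α)` of all points of the algebraic closure of `K` that the `n`-th iterate
of the map `x ↦ f(x)` sends to `α`.  For `n = 0` this is `{α}`. -/
def iteratedPreimage {K : Type*} [Field K] (f : K[X]) (α : K) (n : ℕ) :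
    Set (AlgebraicClosure K) :=
  {β | (fun x : AlgebraicClosure K => aeval x f)^[n] β = algebraMap K (AlgebraicClosure K) α}

/-- The backward orbit `f^{-∞}(α)`, the union of the sets `f^{-n}(α)` over all `n ≥ 1`. -/
def backwardOrbit {K : Type*} [Field K] (f : K[X]) (α : K) : Set (AlgebraicClosure K) :=
  {β | ∃ n : ℕ, 1 ≤ n ∧ β ∈ iteratedPreimage f α n}

/-- A (finite) point `β` is a ramification point of the polynomial map `f` when `f'(β) = 0`. -/
def IsRamificationPoint {K : Type*} [Field K] (f : K[X]) (β : AlgebraicClosure K) : Prop :=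
  aeval β (derivative f) = 0

/-- The tree `T_∞(f, α)`: its vertices at level `n` are the elements of `f^{-n}(α)` (the levels
are taken as disjoint), and a vertex `β` at level `n + 1` is joined to the vertex `f(β)` at
level `n`. This is the map sending a vertex at level `n + 1` to its parent. -/
noncomputable def treeParent {K : Type*} [Field K] (f : K[X]) (α : K) (n : ℕ)
    (v : iteratedPreimage f α (n + 1)) : iteratedPreimage f α n :=
  ⟨aeval (v : AlgebraicClosure K) f, v.2⟩

/-- `Aut(T_∞(f, α))`: automorphisms of the rooted tree, i.e. families of permutations of the
levels that are compatible with the parent maps. -/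
def treeAut {K : Type*} [Field K] (f : K[X]) (α : K) :
    Subgroup (∀ n : ℕ, Equiv.Perm (iteratedPreimage f α n)) where
  carrier := {σ | ∀ (n : ℕ) (v : iteratedPreimage f α (n + 1)),
    treeParent f α n (σ (n + 1) v) = σ n (treeParent f α n v)}
  mul_mem' := by
    intro σ τ hσ hτ n v
    simp only [Pi.mul_apply, Equiv.Perm.mul_apply]
    rw [hσ, hτ]
  one_mem' := fun _ _ => rfl
  inv_mem' := by
    intro σ hσ n v
    simp only [Pi.inv_apply]
    rw [Equiv.Perm.eq_inv_iff_eq, ← hσ n]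
    exact congrArg _ (Equiv.apply_symm_apply (σ (n + 1)) v)

theorem galois_mem_iteratedPreimage {K : Type*} [Field K] (f : K[X]) (α : K)
    (s : (AlgebraicClosure K ≃ₐ[K] AlgebraicClosure K)) (n : ℕ) {β : AlgebraicClosure K}
    (hβ : β ∈ iteratedPreimage f α n) : s β ∈ iteratedPreimage f α n := by
  have h : Function.Semiconj s (fun x : AlgebraicClosure K => aeval x f)
      (fun x : AlgebraicClosure K => aeval x f) := fun x =>
    (Polynomial.aeval_algHom_apply (s : AlgebraicClosure K →ₐ[K] AlgebraicClosure K) x f).symm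
  have h2 := (h.iterate_right n).eq β
  have h3 : (fun x : AlgebraicClosure K => aeval x f)^[n] β
    = algebraMap K (AlgebraicClosure K) α := hβ
  rw [h3, AlgEquiv.commutes] at h2
  exact h2.symm

/-- The arboreal representation `ρ_{f,α} : G_K → Aut(T_∞(f, α))`: an element of the absolute
Galois group acts on every level `f^{-n}(α)` by its action on the algebraic closure. -/
noncomputable def arborealRep {K : Type*} [Field K] (f : K[X]) (α : K) :
    (AlgebraicClosure K ≃ₐ[K] AlgebraicClosure K) →* treeAut f α where
  toFun s :=
    ⟨fun n =>
      { toFun := fun v => ⟨s v.1, galois_mem_iteratedPreimage f α s n v.2⟩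
        invFun := fun v => ⟨s⁻¹ v.1, galois_mem_iteratedPreimage f α s⁻¹ n v.2⟩
        left_inv := fun v => Subtype.ext (AlgEquiv.symm_apply_apply s v.1)
        right_inv := fun v => Subtype.ext (AlgEquiv.apply_symm_apply s v.1) },
      fun _ v => Subtype.ext (Polynomial.aeval_algHom_apply
        (s : AlgebraicClosure K →ₐ[K] AlgebraicClosure K) v.1 f)⟩
  map_one' := rfl
  map_mul' _ _ := rfl

/-- The adjusted post-critical orbit of `x² + c`, indexed from `0`: the value at `n` is
`c_{n+1}`, where `c_1 = -c` and `c_n = c_{n-1}² + c` for `n ≥ 2`. -/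
def adjustedOrbit {K : Type*} [Field K] (c : K) : ℕ → K
  | 0 => -c
  | n + 1 => adjustedOrbit c n ^ 2 + c

/-- The sequence `c_{n,α}`, indexed from `0`: the value at `n` is `c_{n+1,α}`, where
`c_{1,α} = c_1 + α` and `c_{n,α} = c_n - α` for `n ≥ 2`. -/
def adjustedOrbitAt {K : Type*} [Field K] (c α : K) : ℕ → K
  | 0 => adjustedOrbit c 0 + α
  | n + 1 => adjustedOrbit c (n + 1) - α

/-- The group `Kˣ / (Kˣ)²`, written additively. -/
abbrev SquareClasses (K : Type*) [Field K] : Type _ :=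
  Additive (Kˣ ⧸ (powMonoidHom 2 : Kˣ →* Kˣ).range)

/-- `Kˣ / (Kˣ)²` is a vector space over the field with two elements. -/
instance squareClassesModule (K : Type*) [Field K] : Module (ZMod 2) (SquareClasses K) :=
  AddCommGroup.zmodModule (n := 2) (G := SquareClasses K) fun x => by
    obtain ⟨u, hu⟩ := QuotientGroup.mk_surjective (Additive.toMul x)
    apply Additive.toMul.injective
    rw [toMul_nsmul, ← hu, ← QuotientGroup.mk_pow, toMul_zero, QuotientGroup.eq_one_iff]
    exact ⟨u, rfl⟩

/-- The class in `Kˣ / (Kˣ)²` of a nonzero element of `K`. -/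
def squareClass {K : Type*} [Field K] (u : Kˣ) : SquareClasses K :=
  Additive.ofMul (QuotientGroup.mk u)

/-!
Write `f = x² + c`. For a vertex `γ` of the tree and a square root `δ` of `γ - c`, the adjusted
orbit factors as `c_{n+1,γ} = c_{n,δ} c_{n,-δ}`. Since `c_{1,γ} = γ - c` is the square of a vertex,
every `c_{n,γ}` is by induction the square of a product of vertices
(`exists_isCommutingPoint_sq_eq`). If the image of the arboreal representation is abelian, any two
Galois automorphisms commute on such products.

Apply this to the first level, where `δ² = α - c`, and choose a Galois automorphism `τ` with
`τ δ = -δ`, which exists by irreducibility. If `P² = c_{n,δ}`, then `(P · τ P)² = c_{n+1,α}`. An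
automorphism `σ` fixing `δ` multiplies `P` by a sign and, because it commutes with `τ`, multiplies
`τ P` by the same sign; hence it fixes `P · τ P`. So `P · τ P` is fixed by the stabilizer of `δ`,
a subgroup of index two, and either `P · τ P` or `δ · P · τ P` is fixed by the whole Galois group
(`isSquare_or_isSquare_mul_of_fixedBy_stabilizer`). Thus `c_{n+1,α}` is a square or `α - c` times a
square, while `α - c` itself is not a square. Non-vanishing holds because a zero of `c_{n,α}` would
put the ramification point `0` in the backward orbit.
-/

/-- An element of the algebraic closure on which any two elements of the absolute Galois group
commute. -/
def IsCommutingPoint {K : Type*} [Field K] (x : AlgebraicClosure K) : Prop :=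
  ∀ σ τ : AlgebraicClosure K ≃ₐ[K] AlgebraicClosure K, σ (τ x) = τ (σ x)

theorem IsCommutingPoint.mul {K : Type*} [Field K] {x y : AlgebraicClosure K}
    (hx : IsCommutingPoint x) (hy : IsCommutingPoint y) : IsCommutingPoint (x * y) :=
  fun σ τ => by simp only [map_mul, hx σ τ, hy σ τ]

theorem isCommutingPoint_of_mem_iteratedPreimage {K : Type*} [Field K] {f : K[X]} {α : K}
    (hab : IsMulCommutative (arborealRep f α).range) {n : ℕ} {β : AlgebraicClosure K}
    (hβ : β ∈ iteratedPreimage f α n) : IsCommutingPoint β := by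
  intro σ τ
  have h : arborealRep f α σ * arborealRep f α τ = arborealRep f α τ * arborealRep f α σ :=
    congrArg Subtype.val (hab.is_comm.comm ⟨arborealRep f α σ, σ, rfl⟩ ⟨arborealRep f α τ, τ, rfl⟩)
  exact congrArg (fun g : treeAut f α => ((g.1 n ⟨β, hβ⟩ : iteratedPreimage f α n) :
    AlgebraicClosure K)) h

theorem mem_iteratedPreimage_succ {K : Type*} [Field K] {c α : K} {n : ℕ}
    {γ δ : AlgebraicClosure K} (hγ : γ ∈ iteratedPreimage (X ^ 2 + C c) α n)
    (hδ : δ ^ 2 = γ - algebraMap K _ c) : δ ∈ iteratedPreimage (X ^ 2 + C c) α (n + 1) := by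
  have h : aeval δ (X ^ 2 + C c : K[X]) = γ := by simp [hδ]
  simpa only [iteratedPreimage, Set.mem_ofPred_eq, Function.iterate_succ_apply, h] using hγ

theorem adjustedOrbitAt_succ_eq_mul {R : Type*} [Field R] {c α δ : R} (h : δ ^ 2 = α - c) (n : ℕ) :
    adjustedOrbitAt c α (n + 1) = adjustedOrbitAt c δ n * adjustedOrbitAt c (-δ) n := by
  cases n <;> simp only [adjustedOrbitAt, adjustedOrbit] <;> linear_combination h

/-- The base point `γ` may lie outside `K`, so the adjusted orbit is taken in the algebraic
closure. -/
theorem exists_isCommutingPoint_sq_eq {K : Type*} [Field K] {c α : K}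
    (hab : IsMulCommutative (arborealRep (X ^ 2 + C c : K[X]) α).range) (n : ℕ) :
    ∀ (k : ℕ) (γ : AlgebraicClosure K), γ ∈ iteratedPreimage (X ^ 2 + C c) α k →
      ∃ P, IsCommutingPoint P ∧ P ^ 2 = adjustedOrbitAt (algebraMap K _ c) γ n := by
  have hsqrt (γ : AlgebraicClosure K) : ∃ δ, δ ^ 2 = γ - algebraMap K _ c :=
    IsAlgClosed.exists_pow_nat_eq _ two_pos
  induction n with
  | zero =>
    intro k γ hγ
    obtain ⟨δ, hδ⟩ := hsqrt γ
    refine ⟨δ, isCommutingPoint_of_mem_iteratedPreimage hab (mem_iteratedPreimage_succ hγ hδ), ?_⟩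
    simp only [adjustedOrbitAt, adjustedOrbit]
    rw [hδ]
    ring
  | succ n ih =>
    intro k γ hγ
    obtain ⟨δ, hδ⟩ := hsqrt γ
    obtain ⟨P, hP, hP2⟩ := ih _ δ (mem_iteratedPreimage_succ hγ hδ)
    obtain ⟨Q, hQ, hQ2⟩ := ih _ (-δ) (mem_iteratedPreimage_succ hγ (by rw [neg_sq, hδ]))
    refine ⟨P * Q, hP.mul hQ, ?_⟩
    rw [mul_pow, hP2, hQ2, ← adjustedOrbitAt_succ_eq_mul hδ]

theorem map_adjustedOrbit {K L : Type*} [Field K] [Field L] (φ : K →+* L) (c : K) (n : ℕ) :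
    φ (adjustedOrbit c n) = adjustedOrbit (φ c) n := by
  induction n with
  | zero => simp [adjustedOrbit]
  | succ n ih => simp [adjustedOrbit, ih]

theorem map_adjustedOrbitAt {K L : Type*} [Field K] [Field L] (φ : K →+* L) (c α : K) (n : ℕ) :
    φ (adjustedOrbitAt c α n) = adjustedOrbitAt (φ c) (φ α) n := by
  cases n <;> simp [adjustedOrbitAt, map_adjustedOrbit]

theorem irreducible_X_sq_sub_C_of_not_isSquare {K : Type*} [Field K] {d : K} (hd : ¬ IsSquare d) :
    Irreducible (X ^ 2 - C d : K[X]) :=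
  X_pow_sub_C_irreducible_of_prime Nat.prime_two fun b hb => hd ⟨b, by rw [← hb, sq]⟩

theorem exists_algEquiv_apply_eq_neg {K : Type*} [Field K] {d : K} (hd : ¬ IsSquare d)
    {y : AlgebraicClosure K} (hy : y ^ 2 = algebraMap K _ d) :
    ∃ τ : AlgebraicClosure K ≃ₐ[K] AlgebraicClosure K, τ y = -y := by
  have hmin : minpoly K y = X ^ 2 - C d :=
    (minpoly.eq_of_irreducible_of_monic (irreducible_X_sq_sub_C_of_not_isSquare hd)
      (by simp [hy]) (monic_X_pow_sub_C d two_ne_zero)).symm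
  exact minpoly.exists_algEquiv_of_root' (Algebra.IsAlgebraic.isAlgebraic y)
    (by rw [hmin]; simp [hy])

theorem isSquare_of_forall_algEquiv_apply_eq {K : Type*} [Field K] (h2 : (2 : K) ≠ 0) {d : K}
    {y : AlgebraicClosure K} (hy : y ^ 2 = algebraMap K _ d)
    (hfix : ∀ σ : AlgebraicClosure K ≃ₐ[K] AlgebraicClosure K, σ y = y) : IsSquare d := by
  by_contra hd
  obtain ⟨τ, hτ⟩ := exists_algEquiv_apply_eq_neg hd hy
  rw [hfix τ] at hτ
  have h2' : (2 : AlgebraicClosure K) ≠ 0 := by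
    rw [← map_ofNat (algebraMap K (AlgebraicClosure K)) 2]
    exact (map_ne_zero (algebraMap K (AlgebraicClosure K))).2 h2
  have hy0 : y = 0 := by
    have : 2 * y = 0 := by linear_combination hτ
    exact (mul_eq_zero.1 this).resolve_left h2'
  have hd0 : d = 0 := by simpa [hy0] using hy.symm
  exact hd (hd0 ▸ IsSquare.zero)

/-- A square root of an element of `K` fixed by the stabilizer of `√e` lies in `K(√e)`; hence its
square is trivial or equal to `e` modulo squares. -/
theorem isSquare_or_isSquare_mul_of_fixedBy_stabilizer {K : Type*} [Field K] (h2 : (2 : K) ≠ 0)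
    {d e : K} (he : ¬ IsSquare e) {δ y : AlgebraicClosure K} (hδ : δ ^ 2 = algebraMap K _ e)
    (hy : y ^ 2 = algebraMap K _ d)
    (hfix : ∀ σ : AlgebraicClosure K ≃ₐ[K] AlgebraicClosure K, σ δ = δ → σ y = y) :
    IsSquare d ∨ IsSquare (e * d) := by
  obtain ⟨τ, hτ⟩ := exists_algEquiv_apply_eq_neg he hδ
  have hsign (σ : AlgebraicClosure K ≃ₐ[K] AlgebraicClosure K) : σ δ = δ ∨ σ δ = -δ := by
    rw [← sq_eq_sq_iff_eq_or_eq_neg, ← map_pow, hδ, AlgEquiv.commutes]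
  -- The automorphisms sending `δ` to `-δ` form one coset of the stabilizer, so they act alike.
  have hcoset (σ : AlgebraicClosure K ≃ₐ[K] AlgebraicClosure K) (hσ : σ δ = -δ) : σ y = τ y := by
    have h1 : τ⁻¹ (σ y) = y := hfix (τ⁻¹ * σ) (by
      change τ.symm (σ δ) = δ
      rw [hσ, ← hτ, AlgEquiv.symm_apply_apply])
    have h2 := congrArg τ h1
    rwa [show τ (τ⁻¹ (σ y)) = σ y from AlgEquiv.apply_symm_apply τ _] at h2
  have hτy : τ y = y ∨ τ y = -y := by
    rw [← sq_eq_sq_iff_eq_or_eq_neg, ← map_pow, hy, AlgEquiv.commutes]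
  rcases hτy with hτy | hτy
  · left
    refine isSquare_of_forall_algEquiv_apply_eq h2 hy fun σ => ?_
    rcases hsign σ with hσ | hσ
    · exact hfix σ hσ
    · rw [hcoset σ hσ, hτy]
  · right
    refine isSquare_of_forall_algEquiv_apply_eq h2 (y := δ * y)
      (by rw [mul_pow, hδ, hy, map_mul]) fun σ => ?_
    rcases hsign σ with hσ | hσ
    · rw [map_mul, hσ, hfix σ hσ]
    · rw [map_mul, hσ, hcoset σ hσ, hτy, neg_mul_neg]

theorem not_isSquare_of_irreducible {K : Type*} [Field K] {c α : K}
    (hirr : Irreducible (X ^ 2 + C c - C α : K[X])) : ¬ IsSquare (α - c) := by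
  rintro ⟨b, hb⟩
  have hfac : (X ^ 2 + C c - C α : K[X]) = (X - C b) * (X + C b) := by
    have h : (C α : K[X]) - C c = C b * C b := by rw [← C_sub, hb, C_mul]
    linear_combination -h
  rcases hirr.isUnit_or_isUnit hfac with h | h
  · exact not_isUnit_X_sub_C b h
  · exact not_isUnit_X_sub_C (-b) (by simpa using h)

theorem isSquare_or_isSquare_mul_adjustedOrbitAt {K : Type*} [Field K] (h2 : (2 : K) ≠ 0) {c α : K}
    (hab : IsMulCommutative (arborealRep (X ^ 2 + C c : K[X]) α).range)
    (hsq : ¬ IsSquare (α - c)) (n : ℕ) :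
    IsSquare (adjustedOrbitAt c α n) ∨ IsSquare ((α - c) * adjustedOrbitAt c α n) := by
  cases n with
  | zero => exact Or.inr ⟨α - c, by simp only [adjustedOrbitAt, adjustedOrbit]; ring⟩
  | succ n =>
    obtain ⟨δ, hδ⟩ : ∃ δ : AlgebraicClosure K, δ ^ 2 = algebraMap K _ (α - c) :=
      IsAlgClosed.exists_pow_nat_eq _ two_pos
    have hδ' : δ ^ 2 = algebraMap K _ α - algebraMap K (AlgebraicClosure K) c := by
      rw [hδ, map_sub]
    have hmem : δ ∈ iteratedPreimage (X ^ 2 + C c) α 1 :=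
      mem_iteratedPreimage_succ (n := 0) (γ := algebraMap K _ α) rfl hδ'
    obtain ⟨τ, hτ⟩ := exists_algEquiv_apply_eq_neg hsq hδ
    obtain ⟨P, hP, hP2⟩ := exists_isCommutingPoint_sq_eq hab n 1 δ hmem
    have hτP : τ P ^ 2 = adjustedOrbitAt (algebraMap K _ c) (-δ) n := by
      have h := map_adjustedOrbitAt (τ : AlgebraicClosure K →+* AlgebraicClosure K)
        (algebraMap K _ c) δ n
      simp only [RingHom.coe_coe, AlgEquiv.commutes, hτ] at h
      rw [← map_pow, hP2, h]
    refine isSquare_or_isSquare_mul_of_fixedBy_stabilizer h2 hsq hδ (y := P * τ P) ?_ ?_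
    · rw [mul_pow, hP2, hτP, ← adjustedOrbitAt_succ_eq_mul hδ', ← map_adjustedOrbitAt]
    · intro σ hσ
      have hσP : σ P = P ∨ σ P = -P := by
        have h := map_adjustedOrbitAt (σ : AlgebraicClosure K →+* AlgebraicClosure K)
          (algebraMap K _ c) δ n
        simp only [RingHom.coe_coe, AlgEquiv.commutes, hσ] at h
        rw [← sq_eq_sq_iff_eq_or_eq_neg, ← map_pow, hP2, h]
      rw [map_mul, hP σ τ]
      rcases hσP with h | h <;> simp [h]

theorem adjustedOrbit_succ_eq_iterate {K : Type*} [Field K] (c : K) (n : ℕ) :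
    adjustedOrbit c (n + 1) = (fun x : K => x ^ 2 + c)^[n + 2] 0 := by
  induction n with
  | zero => simp [adjustedOrbit]
  | succ n ih => rw [adjustedOrbit, ih, Function.iterate_succ_apply' _ (n + 2)]

theorem adjustedOrbitAt_ne_zero {K : Type*} [Field K] {c α : K}
    (hram : ∀ β ∈ backwardOrbit (X ^ 2 + C c : K[X]) α,
      ¬ IsRamificationPoint (X ^ 2 + C c : K[X]) β) (n : ℕ) : adjustedOrbitAt c α n ≠ 0 := by
  intro h
  have horbit : (fun x : K => x ^ 2 + c)^[n + 1] 0 = α := by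
    cases n with
    | zero =>
      simp only [adjustedOrbitAt, adjustedOrbit] at h
      simp only [zero_add, Function.iterate_one]
      linear_combination -h
    | succ n => rw [← adjustedOrbit_succ_eq_iterate]; exact sub_eq_zero.1 h
  have hsemi : Function.Semiconj (algebraMap K (AlgebraicClosure K)) (fun x : K => x ^ 2 + c)
      (fun x => aeval x (X ^ 2 + C c : K[X])) := fun x => by simp
  refine hram 0 ⟨n + 1, by omega, ?_⟩ (by simp [IsRamificationPoint])
  have := (hsemi.iterate_right (n + 1)).eq 0
  rw [horbit, map_zero] at this
  exact this.symm

theorem squareClass_eq_zero_iff {K : Type*} [Field K] (u : Kˣ) :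
    squareClass u = 0 ↔ IsSquare (u : K) := by
  change (QuotientGroup.mk u : Kˣ ⧸ (powMonoidHom 2 : Kˣ →* Kˣ).range) = 1 ↔ _
  rw [QuotientGroup.eq_one_iff]
  constructor
  · rintro ⟨v, rfl⟩
    exact ⟨v, by simp [sq]⟩
  · rintro ⟨b, hb⟩
    have hb0 : b ≠ 0 := by
      rintro rfl
      simp at hb
    exact ⟨Units.mk0 b hb0, Units.ext (by simp [sq, hb])⟩

theorem squareClass_mul {K : Type*} [Field K] (u v : Kˣ) :
    squareClass (u * v) = squareClass u + squareClass v := rfl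

theorem mainTheorem5 {K : Type*} [Field K] (hK : ringChar K ≠ 2) (c α : K)
    (hram : ∀ β ∈ backwardOrbit (X ^ 2 + C c : K[X]) α,
      ¬ IsRamificationPoint (X ^ 2 + C c : K[X]) β)
    (hab : IsMulCommutative (arborealRep (X ^ 2 + C c : K[X]) α).range)
    (hirr : Irreducible (X ^ 2 + C c - C α : K[X])) :
    ∃ hne : ∀ n : ℕ, adjustedOrbitAt c α n ≠ 0,
      Module.finrank (ZMod 2) (Submodule.span (ZMod 2)
        (Set.range fun n : ℕ => squareClass (Units.mk0 (adjustedOrbitAt c α n) (hne n)))) = 1 := by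
  have hne := adjustedOrbitAt_ne_zero hram
  refine ⟨hne, ?_⟩
  have h2 : (2 : K) ≠ 0 := Ring.two_ne_zero hK
  have hsq := not_isSquare_of_irreducible hirr
  have h0 : adjustedOrbitAt c α 0 = α - c := by
    simp only [adjustedOrbitAt, adjustedOrbit]
    ring
  have hmain := isSquare_or_isSquare_mul_adjustedOrbitAt h2 hab hsq
  rw [← h0] at hsq hmain
  set s : ℕ → SquareClasses K :=
    fun n => squareClass (Units.mk0 (adjustedOrbitAt c α n) (hne n)) with hs
  have hs0 : s 0 ≠ 0 := fun h => hsq ((squareClass_eq_zero_iff _).1 h)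
  have hspan : Submodule.span (ZMod 2) (Set.range s) = Submodule.span (ZMod 2) {s 0} := by
    refine le_antisymm (Submodule.span_le.2 ?_)
      (Submodule.span_mono (Set.singleton_subset_iff.2 ⟨0, rfl⟩))
    rintro _ ⟨n, rfl⟩
    rcases hmain n with h | h
    · rw [show s n = 0 from (squareClass_eq_zero_iff _).2 h]
      exact Submodule.zero_mem _
    · have hadd : s 0 + s n = 0 := by
        simp only [hs]
        rw [← squareClass_mul, squareClass_eq_zero_iff]
        simpa using h
      refine (Submodule.add_mem_iff_right _ (Submodule.mem_span_singleton_self (s 0))).1 ?_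
      rw [hadd]
      exact Submodule.zero_mem _
  rw [hspan]
  exact finrank_span_singleton hs0
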